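/- A clique covering of a finite graph $G$ is a set $\mathcal C$ of cliques of $G$ (a clique being a set of pairwise adjacent vertices) such that both endpoints of every edge of $G$ lie in a common member of $\mathcal C$. Its weight is $\sum_{K\in\mathcal C}|K|$, and the sigma clique cover number $\mathrm{scc}(G)$ is the smallest weight of a clique covering of $G$. Let $K_t(d)$ denote the complete $t$-partite graph with each part of size $d$. Then for every fixed integer $d\ge 2$, $$\lim_{t\to\infty}\frac{\mathrm{scc}(K_t(d))}{t\log_2 t}=\frac d2 .$$ -/

import Mathlib

namespace SimpleGraph

/-- A finite set `C` of vertex sets is a clique covering of `G` if every member of `C` is a clique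
of `G` and every edge of `G` is contained in some member of `C`. -/
structure IsCliqueCovering {V : Type*} (G : SimpleGraph V) (C : Finset (Finset V)) : Prop where
  isClique : ∀ K ∈ C, G.IsClique (K : Set V)
  covers : ∀ v w : V, G.Adj v w → ∃ K ∈ C, v ∈ K ∧ w ∈ K

/-- The weight of a set of cliques: the sum of the sizes of the cliques in it. -/
def cliqueWeight {V : Type*} (C : Finset (Finset V)) : ℕ :=
  ∑ K ∈ C, K.card

/-- The sigma clique cover number of a finite graph `G`: the smallest possible weight of a clique
covering of `G`. The minimum is attained, see `exists_cliqueWeight_eq_scc`. -/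
noncomputable def scc {V : Type*} [Finite V] (G : SimpleGraph V) : ℕ :=
  sInf {w : ℕ | ∃ C : Finset (Finset V), G.IsCliqueCovering C ∧ cliqueWeight C = w}

/-- Every finite graph has a clique covering: take all of its cliques. -/
theorem exists_isCliqueCovering {V : Type*} [Finite V] (G : SimpleGraph V) :
    ∃ C : Finset (Finset V), G.IsCliqueCovering C := by
  classical
  have hfin : {K : Finset V | G.IsClique (K : Set V)}.Finite := Set.toFinite _
  refine ⟨hfin.toFinset, ⟨fun K hK => by simpa using hK, fun v w h => ⟨{v, w}, ?_, by simp, by simp⟩⟩⟩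
  simp [h]

/-- The sigma clique cover number is a genuine minimum. -/
theorem exists_cliqueWeight_eq_scc {V : Type*} [Finite V] (G : SimpleGraph V) :
    ∃ C : Finset (Finset V), G.IsCliqueCovering C ∧ cliqueWeight C = G.scc := by
  obtain ⟨C, hC⟩ := G.exists_isCliqueCovering
  exact Nat.sInf_mem (s := {w : ℕ | ∃ C : Finset (Finset V),
    G.IsCliqueCovering C ∧ cliqueWeight C = w}) ⟨_, C, hC, rfl⟩

end SimpleGraph

/-! Lower bound: for fixed letters `j ≠ k`, let `A i` and `B i` be the sets of cliques through `(i,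
j)` and `(i, k)`. The two vertices are nonadjacent, so `A i` and `B i` are disjoint; edges between
parts force `A i` to meet `B i'` for `i ≠ i'`. A set-pair inequality and convexity bound the total
degree on these two letters by `t log₂ t`; averaging over letter pairs gives the factor `d / 2`.

Upper bound: read each coordinate of a code of `t` words over `Fin d` as a transversal clique. If
any two distinct words show every ordered pair of distinct letters at some coordinate, these cliques
and `d` constant ones form a covering, so codes of length about `(d / 2) log₂ t` suffice. For a
single pair, colour balanced words by merging its two letters: words of one colour are independent
for that pair, at rate near `2 / d`. `exists_coloring_pi` handles all pairs at once with negligible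
loss of rate, and pigeonhole on colours yields the code. -/

/-- A family of set pairs `(A i, B i)` with `A i` disjoint from `B i` and `A i` meeting `B j` for
`i ≠ j` satisfies `∑ 2 ^ (-(|A i| + |B i|)) ≤ 1`. -/
theorem sum_half_pow_card_le_one {α ι : Type*} [DecidableEq α] [Fintype ι] (U : Finset α)
    (A B : ι → Finset α) (hA : ∀ i, A i ⊆ U) (hB : ∀ i, B i ⊆ U)
    (hdisj : ∀ i, Disjoint (A i) (B i)) (hmeet : ∀ i j, i ≠ j → ¬ Disjoint (A i) (B j)) :
    ∑ i, (1 / 2 : ℝ) ^ ((A i).card + (B i).card) ≤ 1 := by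
  classical
  have hsub : ∀ i, A i ⊆ U \ B i := fun i =>
    Finset.subset_sdiff.2 ⟨hA i, hdisj i⟩
  -- Subsets of `U` containing `A i` and avoiding `B i` make up a fraction `2 ^ (-(|A i| + |B i|))`
  -- of the power set. A set common to indices `i ≠ j` would separate `A i` from `B j`.
  have hpair : ((Finset.univ : Finset ι) : Set ι).PairwiseDisjoint
      (fun i => Finset.Icc (A i) (U \ B i)) := by
    intro i _ j _ hij
    refine Finset.disjoint_left.2 fun S hi hj => hmeet i j hij ?_
    rw [Finset.mem_Icc] at hi hj
    exact Finset.disjoint_of_subset_left (hi.1.trans hj.2) Finset.sdiff_disjoint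
  have hcard : ∑ i, (Finset.Icc (A i) (U \ B i)).card ≤ 2 ^ U.card := by
    rw [← Finset.card_biUnion fun i hi j hj hij => hpair hi hj hij, ← Finset.card_powerset]
    refine Finset.card_le_card fun S hS => ?_
    obtain ⟨i, -, hi⟩ := Finset.mem_biUnion.1 hS
    exact Finset.mem_powerset.2 ((Finset.mem_Icc.1 hi).2.trans Finset.sdiff_subset)
  have hterm : ∀ i, ((Finset.Icc (A i) (U \ B i)).card : ℝ) =
      2 ^ U.card * (1 / 2 : ℝ) ^ ((A i).card + (B i).card) := by
    intro i
    have h1 := Finset.card_le_card (hsub i)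
    have h2 := Finset.card_sdiff_of_subset (hB i)
    have h3 := Finset.card_le_card (hB i)
    have h4 : U.card = ((U \ B i).card - (A i).card) + ((A i).card + (B i).card) := by omega
    have h5 : (2 : ℝ) ^ U.card = 2 ^ ((U \ B i).card - (A i).card) *
        2 ^ ((A i).card + (B i).card) := by rw [← pow_add, ← h4]
    rw [Finset.card_Icc_finset (hsub i), h5, mul_assoc, ← mul_pow]
    norm_num
  have hcard' : (∑ i, ((Finset.Icc (A i) (U \ B i)).card : ℝ)) ≤ 2 ^ U.card := by
    exact_mod_cast hcard
  simp_rw [hterm, ← Finset.mul_sum] at hcard'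
  exact le_of_mul_le_mul_left (by simpa using hcard') (by positivity : (0 : ℝ) < 2 ^ U.card)

/-- If `∑ 2 ^ (-w i) ≤ 1` over `t` indices, then `∑ w i ≥ t log₂ t`. -/
theorem card_mul_logb_card_le_sum {ι : Type*} [Fintype ι] (w : ι → ℕ)
    (hw : ∑ i, (1 / 2 : ℝ) ^ w i ≤ 1) :
    (Fintype.card ι : ℝ) * Real.logb 2 (Fintype.card ι) ≤ ∑ i, (w i : ℝ) := by
  rcases isEmpty_or_nonempty ι with h | h
  · simp
  set t : ℝ := (Fintype.card ι : ℝ) with ht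
  have ht0 : 0 < t := by rw [ht]; exact_mod_cast Fintype.card_pos
  have h2 : 0 < Real.log 2 := Real.log_pos (by norm_num)
  -- This is `log x ≤ x - 1` at `x = t * 2 ^ (-w i)`; summed over `i`, the right side is at most `t
  -- - t = 0`.
  have hterm : ∀ i, Real.log t - w i * Real.log 2 ≤ t * (1 / 2 : ℝ) ^ w i - 1 := by
    intro i
    have := Real.log_le_sub_one_of_pos (x := t * (1 / 2 : ℝ) ^ w i) (by positivity)
    rw [Real.log_mul ht0.ne' (by positivity), Real.log_pow, one_div, Real.log_inv] at this
    rw [one_div]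
    linarith
  have hsum := Finset.sum_le_sum fun i (_ : i ∈ Finset.univ) => hterm i
  simp only [Finset.sum_sub_distrib, Finset.sum_const, ← Finset.sum_mul, ← Finset.mul_sum,
    Finset.card_univ, nsmul_eq_mul, ← ht] at hsum
  have : t * Real.log t ≤ (∑ i, (w i : ℝ)) * Real.log 2 := by nlinarith
  rw [Real.logb, ← mul_div_assoc, div_le_iff₀ h2]
  exact this

/-! ### Lower bound, and coverings from codes -/

namespace SimpleGraph

theorem cliqueWeight_eq_sum_card_filter {V : Type*} [Fintype V] [DecidableEq V]
    (C : Finset (Finset V)) : cliqueWeight C = ∑ v, (C.filter (v ∈ ·)).card := by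
  have := Finset.sum_card_bipartiteAbove_eq_sum_card_bipartiteBelow (s := C)
    (t := (Finset.univ : Finset V)) (fun K v => v ∈ K)
  simpa [Finset.bipartiteAbove, Finset.bipartiteBelow, cliqueWeight] using this

theorem scc_le_cliqueWeight {V : Type*} [Finite V] {G : SimpleGraph V} {C : Finset (Finset V)}
    (hC : G.IsCliqueCovering C) : G.scc ≤ cliqueWeight C :=
  Nat.sInf_le ⟨C, hC, rfl⟩

theorem scc_completeEquipartiteGraph_ge (t d : ℕ) (hd : 2 ≤ d) :
    (d : ℝ) / 2 * (t * Real.logb 2 t) ≤ (completeEquipartiteGraph t d).scc := by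
  classical
  obtain ⟨C, hC, hw⟩ := exists_cliqueWeight_eq_scc (completeEquipartiteGraph t d)
  rw [← hw, cliqueWeight_eq_sum_card_filter]
  set s : Fin t → Fin d → ℕ := fun i j => (C.filter ((i, j) ∈ ·)).card with hs
  have hpair : ∀ j k : Fin d, k ≠ j →
      (t : ℝ) * Real.logb 2 t ≤ ∑ i, ((s i j : ℝ) + s i k) := by
    intro j k hjk
    have h := card_mul_logb_card_le_sum _ (sum_half_pow_card_le_one C
      (fun i : Fin t => C.filter ((i, j) ∈ ·)) (fun i : Fin t => C.filter ((i, k) ∈ ·))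
      (fun i => Finset.filter_subset _ _) (fun i => Finset.filter_subset _ _)
      (fun i => ?_) (fun i i' hii' => ?_))
    · simpa [hs] using h
    · refine Finset.disjoint_left.2 fun K h1 h2 => ?_
      rw [Finset.mem_filter] at h1 h2
      have := hC.isClique K h1.1 h1.2 h2.2 (by simp [hjk.symm])
      simp at this
    · obtain ⟨K, hK, h1, h2⟩ := hC.covers (i, j) (i', k) hii'
      exact Finset.not_disjoint_iff.2
        ⟨K, Finset.mem_filter.2 ⟨hK, h1⟩, Finset.mem_filter.2 ⟨hK, h2⟩⟩
  have hd1 : (1 : ℝ) ≤ (d : ℝ) - 1 := by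
    have : (2 : ℝ) ≤ d := by exact_mod_cast hd
    linarith
  set W : ℝ := ∑ i, ∑ j, (s i j : ℝ) with hW
  -- Over ordered pairs of distinct letters, each `s i j` is counted `2 * (d - 1)` times.
  have hsum : ∑ j : Fin d, ∑ k ∈ Finset.univ.erase j, ((t : ℝ) * Real.logb 2 t) ≤
      ∑ j : Fin d, ∑ k ∈ Finset.univ.erase j, ∑ i, ((s i j : ℝ) + s i k) :=
    Finset.sum_le_sum fun j _ => Finset.sum_le_sum fun k hk =>
      hpair j k (Finset.ne_of_mem_erase hk)
  have hcast : ((d - 1 : ℕ) : ℝ) = d - 1 := by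
    rw [Nat.cast_sub (by omega)]; simp
  have hL : ∑ j : Fin d, ∑ k ∈ Finset.univ.erase j, ((t : ℝ) * Real.logb 2 t) =
      d * ((d - 1) * (t * Real.logb 2 t)) := by
    simp [Finset.card_erase_of_mem, hcast]
  have hsw : ∑ j : Fin d, ∑ i, (s i j : ℝ) = W := Finset.sum_comm
  have hR : ∑ j : Fin d, ∑ k ∈ Finset.univ.erase j, ∑ i, ((s i j : ℝ) + s i k) =
      2 * ((d - 1) * W) := by
    have : ∀ j : Fin d, ∑ k ∈ Finset.univ.erase j, ∑ i, ((s i j : ℝ) + s i k) =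
        (d - 1) * ∑ i, (s i j : ℝ) + (W - ∑ i, (s i j : ℝ)) := by
      intro j
      rw [Finset.sum_erase_eq_sub (Finset.mem_univ j)]
      simp only [Finset.sum_add_distrib, Finset.sum_const, Finset.card_univ, Fintype.card_fin,
        nsmul_eq_mul, hsw]
      ring
    rw [Finset.sum_congr rfl fun j _ => this j]
    simp only [Finset.sum_add_distrib, Finset.sum_sub_distrib, ← Finset.mul_sum, hsw,
      Finset.sum_const, Finset.card_univ, Fintype.card_fin, nsmul_eq_mul]
    ring
  have hfin : (((∑ v : Fin t × Fin d, (C.filter (v ∈ ·)).card : ℕ)) : ℝ) = W := by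
    rw [Fintype.sum_prod_type]
    push_cast
    rfl
  rw [hfin]
  rw [hL, hR] at hsum
  have : (d - 1) * (d * (t * Real.logb 2 t)) ≤ (d - 1) * (2 * W) := by linarith
  have := le_of_mul_le_mul_left this (by linarith)
  linarith

/-- A family of `t` words over `Fin d`, any two of which are qualitatively independent off the
diagonal, yields a clique covering by transversals. -/
theorem scc_completeEquipartiteGraph_le {t d : ℕ} {P : Type*} [Fintype P]
    (f : Fin t → P → Fin d)
    (hf : ∀ x y, x ≠ y → ∀ j k, j ≠ k → ∃ p, f x p = j ∧ f y p = k) :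
    (completeEquipartiteGraph t d).scc ≤ t * (Fintype.card P + d) := by
  classical
  -- The constant transversals `Sum.inr j` cover the edges joining equal letters, on which `hf` is
  -- silent.
  set g : P ⊕ Fin d → Finset (Fin t × Fin d) := fun q =>
    Finset.univ.image fun i => (i, Sum.elim (fun p => f i p) id q) with hg
  have hcov : (completeEquipartiteGraph t d).IsCliqueCovering (Finset.univ.image g) := by
    refine ⟨fun K hK => ?_, fun v w hvw => ?_⟩
    · obtain ⟨q, -, rfl⟩ := Finset.mem_image.1 hK
      intro v hv w hw hne
      simp only [hg, Finset.coe_image, Finset.coe_univ, Set.image_univ, Set.mem_range] at hv hw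
      obtain ⟨i, rfl⟩ := hv
      obtain ⟨i', rfl⟩ := hw
      rw [completeEquipartiteGraph_adj]
      rintro (rfl : i = i')
      exact hne rfl
    · obtain ⟨i, j⟩ := v
      obtain ⟨i', k⟩ := w
      rw [completeEquipartiteGraph_adj] at hvw
      rcases eq_or_ne j k with rfl | hjk
      · exact ⟨g (Sum.inr j), Finset.mem_image_of_mem _ (Finset.mem_univ _), by simp [hg],
          by simp [hg]⟩
      · obtain ⟨p, h1, h2⟩ := hf i i' hvw j k hjk
        exact ⟨g (Sum.inl p), Finset.mem_image_of_mem _ (Finset.mem_univ _), by simp [hg, h1],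
          by simp [hg, h2]⟩
  refine (scc_le_cliqueWeight hcov).trans ?_
  have h1 : ∀ K ∈ Finset.univ.image g, K.card ≤ t := by
    intro K hK
    obtain ⟨q, -, rfl⟩ := Finset.mem_image.1 hK
    exact Finset.card_image_le.trans (by simp)
  have h2 := Finset.sum_le_card_nsmul _ _ _ h1
  have h3 : (Finset.univ.image g).card ≤ Fintype.card P + d :=
    Finset.card_image_le.trans (by simp)
  rw [smul_eq_mul, mul_comm] at h2
  exact h2.trans (Nat.mul_le_mul_left _ h3)

end SimpleGraph

/-! ### Combining colourings -/

/-- From two colourings of `S` one obtains a colouring of `S ^ L` with only one extra factor of `Q`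
colours such that distinct words with the same colour agree in either of the original colours at
some coordinate where they differ. -/
theorem exists_coloring_pi {S : Type*} {Q : ℕ} [NeZero Q] (c₁ c₂ : S → Fin Q) (L : ℕ) :
    ∃ c : (Fin L → S) → Fin (Q ^ (L + 1)), ∀ x y, c x = c y → x ≠ y →
      (∃ l, x l ≠ y l ∧ c₁ (x l) = c₁ (y l)) ∧ (∃ l, x l ≠ y l ∧ c₂ (x l) = c₂ (y l)) := by
  classical
  -- The colour lists `c₁ (x l) - c₂ (x (l - 1))` for `L + 1` positions, with 0 for the missing end
  -- terms. At the first difference of `x` and `y` the `c₂` term cancels, leaving equal `c₁`; just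
  -- after the last, the `c₁` term cancels.
  set a : (Fin L → S) → Fin (L + 1) → Fin Q :=
    fun x => Fin.snoc (α := fun _ => Fin Q) (fun l => c₁ (x l)) 0 with ha
  set b : (Fin L → S) → Fin (L + 1) → Fin Q :=
    fun x => Fin.cons (α := fun _ => Fin Q) 0 (fun l => c₂ (x l)) with hb
  refine ⟨fun x => finFunctionFinEquiv fun i => a x i - b x i, fun x y hxy hne => ?_⟩
  have hsub : ∀ i, a x i - b x i = a y i - b y i :=
    fun i => congrFun (finFunctionFinEquiv.injective hxy) i
  set D : Finset (Fin L) := Finset.univ.filter fun l => x l ≠ y l with hD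
  have hDne : D.Nonempty := by
    obtain ⟨l, hl⟩ := Function.ne_iff.1 hne
    exact ⟨l, by simpa [hD] using hl⟩
  constructor
  · refine ⟨D.min' hDne, by simpa [hD] using D.min'_mem hDne, ?_⟩
    have hlt : ∀ m, m < D.min' hDne → x m = y m := by
      intro m hm
      by_contra h
      exact absurd (D.min'_le m (by simpa [hD] using h)) (not_le.2 hm)
    generalize D.min' hDne = l at hlt
    have hbl : b x l.castSucc = b y l.castSucc := by
      rcases Fin.eq_zero_or_eq_succ l.castSucc with h | ⟨m, h⟩
      · rw [h]; simp [hb]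
      · have hm : m < l := by
          rw [← Fin.castSucc_lt_castSucc_iff, h]; exact Fin.castSucc_lt_succ
        rw [h]; simp [hb, hlt m hm]
    have := hsub l.castSucc
    rw [hbl] at this
    simpa [ha] using sub_left_injective this
  · refine ⟨D.max' hDne, by simpa [hD] using D.max'_mem hDne, ?_⟩
    have hlt : ∀ m, D.max' hDne < m → x m = y m := by
      intro m hm
      by_contra h
      exact absurd (D.le_max' m (by simpa [hD] using h)) (not_le.2 hm)
    generalize D.max' hDne = l at hlt
    have hal : a x l.succ = a y l.succ := by
      rcases Fin.eq_castSucc_or_eq_last l.succ with ⟨m, h⟩ | h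
      · have hm : l < m := by
          rw [← Fin.castSucc_lt_castSucc_iff, ← h]; exact Fin.castSucc_lt_succ
        rw [h]; simp [ha, hlt m hm]
      · rw [h]; simp [ha]
    have := hsub l.succ
    rw [hal] at this
    simpa [hb] using sub_right_injective this

/-- If for each `k ∈ s` the alphabet `T` has a `Q`-colouring with distinct letters of the same
colour `rel k`-related, then long words have a colouring with about `Q` colours per letter such that
distinct words of the same colour are related at some coordinate for every `k ∈ s`. -/
theorem exists_coloring_forall_mem {T κ : Type*} (rel : κ → T → T → Prop) {Q : ℕ} [NeZero Q]
    (L : ℕ) (s : Finset κ)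
    (hbase : ∀ k ∈ s, ∃ c : T → Fin Q, ∀ x y, c x = c y → x ≠ y → rel k x y) :
    ∃ (ι : Type) (_ : Fintype ι) (c : (ι → T) → Fin (Q ^ (L + 1) ^ s.card)),
      Fintype.card ι = L ^ s.card ∧
      ∀ x y, c x = c y → x ≠ y → ∀ k ∈ s, ∃ i, rel k (x i) (y i) := by
  classical
  induction s using Finset.induction_on with
  | empty => exact ⟨Fin 1, inferInstance, fun _ => ⟨0, by simpa using NeZero.pos Q⟩, by simp,
      by simp⟩
  | insert k s hk ih =>
    obtain ⟨ι, _, c₁, hι, hc₁⟩ := ih fun k' hk' => hbase k' (Finset.mem_insert_of_mem hk')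
    obtain ⟨c₀, hc₀⟩ := hbase k (Finset.mem_insert_self k s)
    have hle : Q ^ Fintype.card ι ≤ Q ^ (L + 1) ^ s.card := by
      rw [hι]
      exact Nat.pow_le_pow_right (NeZero.pos Q) (Nat.pow_le_pow_left (Nat.le_succ L) _)
    -- The new relation is handled letter by letter; its fewer colours are padded to match those of
    -- `c₁`.
    set c₂ : (ι → T) → Fin (Q ^ (L + 1) ^ s.card) := fun x =>
      Fin.castLE hle (finFunctionFinEquiv fun i => c₀ (x ((Fintype.equivFin ι).symm i))) with hc₂
    have hc₂' : ∀ x y, c₂ x = c₂ y → ∀ i, c₀ (x i) = c₀ (y i) := by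
      intro x y h i
      have := congrFun (finFunctionFinEquiv.injective (Fin.castLE_injective hle h))
        (Fintype.equivFin ι i)
      simpa using this
    obtain ⟨c, hc⟩ := exists_coloring_pi c₁ c₂ L
    have hcard : (insert k s).card = s.card + 1 := Finset.card_insert_of_notMem hk
    have hQ : (Q ^ (L + 1) ^ s.card) ^ (L + 1) = Q ^ (L + 1) ^ (insert k s).card := by
      rw [hcard, ← pow_mul, ← pow_succ]
    refine ⟨Fin L × ι, inferInstance, fun x => Fin.cast hQ (c fun l i => x (l, i)), ?_, ?_⟩
    · simp [hι, hcard, pow_succ, mul_comm]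
    · intro x y hxy hne k' hk'
      have hne' : (fun l i => x (l, i)) ≠ fun l i => y (l, i) := by
        intro h
        exact hne (funext fun p => congrFun (congrFun h p.1) p.2)
      obtain ⟨⟨l, hl, h1⟩, ⟨l', hl', h2⟩⟩ := hc _ _ (Fin.cast_injective hQ hxy) hne'
      rcases Finset.mem_insert.1 hk' with rfl | hk'
      · obtain ⟨i, hi⟩ := Function.ne_iff.1 hl'
        exact ⟨(l', i), hc₀ _ _ (hc₂' (fun i => x (l', i)) (fun i => y (l', i)) h2 i) hi⟩
      · obtain ⟨i, hi⟩ := hc₁ _ _ h1 hl k' hk'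
        exact ⟨(l, i), hi⟩

/-! ### Balanced words and independent codes -/

/-- The words on `Fin d × Fin m` using each of the `d` letters exactly `m` times. -/
def balancedWords (d m : ℕ) : Finset (Fin d × Fin m → Fin d) :=
  Finset.univ.filter fun w => ∀ a, (Finset.univ.filter fun p => w p = a).card = m

theorem mem_balancedWords {d m : ℕ} {w : Fin d × Fin m → Fin d} :
    w ∈ balancedWords d m ↔ ∀ a, (Finset.univ.filter fun p => w p = a).card = m := by
  simp [balancedWords]

theorem balancedWords_nonempty (d m : ℕ) : (balancedWords d m).Nonempty := by
  refine ⟨Prod.fst, mem_balancedWords.2 fun a => ?_⟩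
  have : (Finset.univ.filter fun p : Fin d × Fin m => p.1 = a) = {a} ×ˢ Finset.univ := by
    ext p
    rw [Finset.mem_filter, Finset.mem_product]
    simp
  rw [this]; simp

/-- The word obtained from `w` by replacing the letter `k` by `j`. -/
def mergeLetter {P A : Type*} [DecidableEq A] (j k : A) (w : P → A) : P → A :=
  fun p => if w p = k then j else w p

/-- Otherwise every `j` of `v` is also a `j` of `w`; both have `m` of them, so the positions
coincide and the merged words determine `v = w`. -/
theorem exists_eq_of_mergeLetter_eq {d m : ℕ} {j k : Fin d}
    {v w : Fin d × Fin m → Fin d} (hv : v ∈ balancedWords d m) (hw : w ∈ balancedWords d m)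
    (h : mergeLetter j k v = mergeLetter j k w) (hne : v ≠ w) : ∃ p, v p = j ∧ w p = k := by
  by_contra hcon
  push Not at hcon
  have hp : ∀ p, (if v p = k then j else v p) = if w p = k then j else w p :=
    fun p => congrFun h p
  have hsub : (Finset.univ.filter fun p => v p = j) ⊆ Finset.univ.filter fun p => w p = j := by
    intro p hpj
    have h1 : v p = j := by simpa using hpj
    have h2 := hcon p h1
    have h3 := hp p
    have : w p = j := by grind
    simpa using this
  have heq := Finset.eq_of_subset_of_card_le hsub
    (by rw [mem_balancedWords.1 hv, mem_balancedWords.1 hw])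
  refine hne (funext fun p => ?_)
  have h3 := hp p
  have h4 : v p = j ↔ w p = j := by simpa using Finset.ext_iff.1 heq p
  grind

/-- The `2 * m` positions where `w` has `j` or `k` can be split evenly between these letters at will
without changing the merged word. -/
theorem centralBinom_le_card_fiber_mergeLetter {d m : ℕ} {j k : Fin d} (hjk : j ≠ k)
    {w : Fin d × Fin m → Fin d} (hw : w ∈ balancedWords d m) :
    m.centralBinom ≤
      ((balancedWords d m).filter fun v => mergeLetter j k v = mergeLetter j k w).card := by
  classical
  rw [mem_balancedWords] at hw
  set S : Finset (Fin d × Fin m) := Finset.univ.filter fun p => w p = j ∨ w p = k with hS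
  have hScard : S.card = 2 * m := by
    rw [hS, Finset.filter_or, Finset.card_union_of_disjoint, hw, hw, two_mul]
    refine Finset.disjoint_left.2 fun p h1 h2 => hjk ?_
    rw [Finset.mem_filter] at h1 h2
    exact h1.2.symm.trans h2.2
  rw [Nat.centralBinom_eq_two_mul_choose, ← hScard, ← Finset.card_powersetCard]
  refine Finset.card_le_card_of_injOn
    (fun U p => if p ∈ U then j else if p ∈ S then k else w p) ?_ ?_
  · intro U hU
    obtain ⟨hUS, hUm⟩ := Finset.mem_powersetCard.1 hU
    have hUS' : ∀ p ∈ U, w p = j ∨ w p = k := fun p hp => by simpa [hS] using hUS hp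
    refine Finset.mem_filter.2 ⟨mem_balancedWords.2 fun a => ?_, funext fun p => ?_⟩
    · rcases eq_or_ne a j with rfl | haj
      · refine Eq.trans (congrArg Finset.card ?_) hUm
        ext p
        simp only [hS, Finset.mem_filter, Finset.mem_univ, true_and]
        grind
      rcases eq_or_ne a k with rfl | hak
      · have : m = (S \ U).card := by rw [Finset.card_sdiff_of_subset hUS]; omega
        refine Eq.trans (congrArg Finset.card ?_) this.symm
        ext p
        simp only [hS, Finset.mem_filter, Finset.mem_univ, true_and, Finset.mem_sdiff]
        grind
      · refine Eq.trans (congrArg Finset.card ?_) (hw a)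
        ext p
        simp only [hS, Finset.mem_filter, Finset.mem_univ, true_and]
        grind
    · simp only [mergeLetter, hS, Finset.mem_filter, Finset.mem_univ, true_and]
      grind
  · intro U hU V hV h
    have hUS := (Finset.mem_powersetCard.1 hU).1
    have hVS := (Finset.mem_powersetCard.1 hV).1
    ext p
    have := congrFun h p
    have h1 := @hUS p
    have h2 := @hVS p
    simp only at this
    grind

theorem card_image_mergeLetter_le {d m : ℕ} {j k : Fin d} (hjk : j ≠ k) :
    ((balancedWords d m).image (mergeLetter j k)).card ≤
      (balancedWords d m).card / m.centralBinom := by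
  classical
  rw [Nat.le_div_iff_mul_le m.centralBinom_pos, mul_comm]
  refine Finset.mul_card_image_le_card _ _ fun q hq => ?_
  obtain ⟨w, hw, rfl⟩ := Finset.mem_image.1 hq
  exact centralBinom_le_card_fiber_mergeLetter hjk hw

/-- Distinct words of the code `f` are qualitatively independent off the diagonal: every pair of
distinct letters occurs at some coordinate. -/
def IsIndependentCode {X P A : Type*} (f : X → P → A) : Prop :=
  ∀ x y, x ≠ y → ∀ j k, j ≠ k → ∃ p, f x p = j ∧ f y p = k

theorem exists_isIndependentCode_pow {d m L K : ℕ} (hd : 2 ≤ d)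
    (hK : (Finset.univ : Finset (Fin d)).offDiag.card = K) :
    ∃ (X P : Type) (_ : Fintype X) (_ : Fintype P) (f : X → P → Fin d),
      IsIndependentCode f ∧
      Fintype.card P = L ^ K * (d * m) ∧
      (balancedWords d m).card ^ L ^ K ≤
        ((balancedWords d m).card / m.centralBinom) ^ (L + 1) ^ K * Fintype.card X := by
  classical
  subst hK
  set Q := (balancedWords d m).card / m.centralBinom with hQ
  have hQ0 : 0 < Q := by
    have h : (⟨0, by omega⟩ : Fin d) ≠ ⟨1, by omega⟩ := by simp
    exact (Finset.card_pos.2 ((balancedWords_nonempty d m).image _)).trans_le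
      (card_image_mergeLetter_le h)
  have : NeZero Q := ⟨hQ0.ne'⟩
  obtain ⟨ι, _, c, hι, hc⟩ := exists_coloring_forall_mem
    (T := balancedWords d m) (κ := Fin d × Fin d)
    (fun jk v w => ∃ p, v.1 p = jk.1 ∧ w.1 p = jk.2) (Q := Q) L
    (Finset.univ : Finset (Fin d)).offDiag (by
      rintro ⟨j, k⟩ hjk
      have hjk' : j ≠ k := by simpa using hjk
      obtain ⟨e⟩ := Function.Embedding.nonempty_of_card_le
        (α := (balancedWords d m).image (mergeLetter j k)) (β := Fin Q)
        (by rw [Fintype.card_coe, Fintype.card_fin]; exact card_image_mergeLetter_le hjk')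
      refine ⟨fun w => e ⟨mergeLetter j k w.1, Finset.mem_image_of_mem _ w.2⟩,
        fun v w h hne => ?_⟩
      exact exists_eq_of_mergeLetter_eq v.2 w.2 (congrArg Subtype.val (e.injective h))
        fun h => hne (Subtype.ext h))
  have : NeZero (Q ^ (L + 1) ^ (Finset.univ : Finset (Fin d)).offDiag.card) := ⟨(pow_pos hQ0 _).ne'⟩
  -- The code is a largest colour class.
  obtain ⟨q, -, hq⟩ := Finset.exists_max_image Finset.univ
    (fun q => (Finset.univ.filter fun x => c x = q).card) Finset.univ_nonempty
  have hcard := Finset.card_le_mul_card_image_of_maps_to (f := c) (s := Finset.univ)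
    (t := Finset.univ) (fun _ _ => Finset.mem_univ _) _ hq
  refine ⟨{x // c x = q}, ι × (Fin d × Fin m), inferInstance, inferInstance,
    fun x p => (x.1 p.1).1 p.2, ?_, ?_, ?_⟩
  · intro x y hxy j k hjk
    obtain ⟨i, p, h⟩ := hc x.1 y.1 (x.2.trans y.2.symm) (fun h => hxy (Subtype.ext h)) (j, k)
      (by simpa using hjk)
    exact ⟨(i, p), h⟩
  · simp [hι]
  · rw [Fintype.card_subtype, mul_comm]
    simpa [hι] using hcard
-- Asymptotics
open Filter Topology

theorem tendsto_mul_div_sub_logb (d : ℝ) :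
    Tendsto (fun m : ℕ => d * m / (2 * m - Real.logb 2 (2 * m) - 1)) atTop (𝓝 (d / 2)) := by
  have hlog : Tendsto (fun x : ℝ => Real.log x / x) atTop (𝓝 0) := by
    simpa using Real.isLittleO_log_id_atTop.tendsto_div_nhds_zero
  have h2m : Tendsto (fun m : ℕ => (2 * m : ℝ)) atTop atTop :=
    tendsto_natCast_atTop_atTop.const_mul_atTop (by norm_num)
  have h1 : Tendsto (fun m : ℕ => Real.logb 2 (2 * m) / (2 * m)) atTop (𝓝 0) := by
    have := (hlog.comp h2m).div_const (Real.log 2)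
    rw [zero_div] at this
    refine this.congr fun m => ?_
    simp only [Function.comp, Real.logb]
    ring
  have h2 : Tendsto (fun m : ℕ => 1 / (2 * m : ℝ)) atTop (𝓝 0) := by
    simp only [one_div]
    exact h2m.inv_tendsto_atTop
  have h3 : Tendsto (fun m : ℕ => d / 2 / (1 - Real.logb 2 (2 * m) / (2 * m) - 1 / (2 * m)))
      atTop (𝓝 (d / 2)) := by
    have := (tendsto_const_nhds (x := d / 2)).div
      (((tendsto_const_nhds (x := (1 : ℝ))).sub h1).sub h2) (by norm_num)
    rwa [sub_zero, sub_zero, div_one] at this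
  refine h3.congr' ?_
  filter_upwards [eventually_gt_atTop 0] with m hm
  have hm' : (0 : ℝ) < m := by exact_mod_cast hm
  have : (1 - Real.logb 2 (2 * m) / (2 * m) - 1 / (2 * m) : ℝ) =
      (2 * m - Real.logb 2 (2 * m) - 1) / (2 * m) := by field_simp
  rw [this, div_div_eq_mul_div]
  congr 1
  ring

/-- The zero-error capacity for off-diagonal qualitative independence over `d` letters is at
least `2 / d`. -/
theorem exists_isIndependentCode_card_le {d : ℕ} (hd : 2 ≤ d) {ε : ℝ} (hε : 0 < ε) :
    ∃ (X P : Type) (_ : Fintype X) (_ : Fintype P) (f : X → P → Fin d),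
      IsIndependentCode f ∧ 1 < Fintype.card X ∧
      (Fintype.card P : ℝ) ≤ (d / 2 + ε) * Real.logb 2 (Fintype.card X) := by
  -- For `d = 2` the quotient tends to 1, so with positive numerator its denominator is eventually
  -- positive.
  have hpos : ∀ᶠ m : ℕ in atTop, (0 : ℝ) < 2 * m - Real.logb 2 (2 * m) - 1 := by
    filter_upwards [(tendsto_mul_div_sub_logb 2).eventually
      (lt_mem_nhds (show (0 : ℝ) < 2 / 2 by norm_num)), eventually_gt_atTop 0] with m hm hm0
    have hm' : (0 : ℝ) < 2 * m := by positivity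
    exact (div_pos_iff_of_pos_left hm').1 hm
  obtain ⟨m, hm, hden, hm0⟩ := (((tendsto_mul_div_sub_logb d).eventually
    (gt_mem_nhds (show (d / 2 : ℝ) < d / 2 + ε by linarith))).and
      (hpos.and (eventually_gt_atTop 0))).exists
  set K := (Finset.univ : Finset (Fin d)).offDiag.card with hK
  set A := (balancedWords d m).card with hA
  set Q := A / m.centralBinom with hQ
  have hA0 : 0 < A := Finset.card_pos.2 (balancedWords_nonempty d m)
  have hB0 : 0 < m.centralBinom := m.centralBinom_pos
  have hQ0 : 0 < Q := by
    have h : (⟨0, by omega⟩ : Fin d) ≠ ⟨1, by omega⟩ := by simp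
    exact (Finset.card_pos.2 ((balancedWords_nonempty d m).image _)).trans_le
      (card_image_mergeLetter_le h)
  have hA0' : (0 : ℝ) < A := by exact_mod_cast hA0
  have hQ0' : (0 : ℝ) < Q := by exact_mod_cast hQ0
  have hB0' : (0 : ℝ) < m.centralBinom := by exact_mod_cast hB0
  have h12 : (1 : ℝ) < 2 := by norm_num
  have hB : 2 * (m : ℝ) - Real.logb 2 (2 * m) ≤ Real.logb 2 m.centralBinom := by
    have h4 : ((4 : ℝ) ^ m) ≤ 2 * m * m.centralBinom := by
      exact_mod_cast Nat.four_pow_le_two_mul_self_mul_centralBinom m hm0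
    have hm' : (0 : ℝ) < 2 * m := by positivity
    have := Real.logb_le_logb_of_le h12 (by positivity) h4
    rw [Real.logb_mul hm'.ne' hB0'.ne', Real.logb_pow,
      show (4 : ℝ) = 2 ^ 2 by norm_num, Real.logb_pow, Real.logb_self_eq_one h12] at this
    push_cast at this
    linarith
  have hAQ : Real.logb 2 m.centralBinom ≤ Real.logb 2 A - Real.logb 2 Q := by
    have h : ((Q * m.centralBinom : ℕ) : ℝ) ≤ A := by exact_mod_cast Nat.div_mul_le_self _ _
    push_cast at h
    have := Real.logb_le_logb_of_le h12 (by positivity) h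
    rw [Real.logb_mul hQ0'.ne' hB0'.ne'] at this
    linarith
  have hlim : Tendsto (fun L : ℕ => Real.logb 2 A - (1 + 1 / (L : ℝ)) ^ K * Real.logb 2 Q) atTop
      (𝓝 (Real.logb 2 A - (1 + 0) ^ K * Real.logb 2 Q)) :=
    tendsto_const_nhds.sub (((tendsto_const_nhds.add tendsto_one_div_atTop_nhds_zero_nat).pow
      K).mul_const _)
  -- The `- 1` is slack that absorbs the factor `(1 + 1 / L) ^ K` for large `L`.
  obtain ⟨L, hL, hL0⟩ := ((hlim.eventually (lt_mem_nhds
    (show 2 * (m : ℝ) - Real.logb 2 (2 * m) - 1 < Real.logb 2 A - (1 + 0) ^ K * Real.logb 2 Q by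
      rw [add_zero, one_pow, one_mul]; linarith))).and (eventually_gt_atTop 0)).exists
  obtain ⟨X, P, _, _, f, hf, hP, hX⟩ := exists_isIndependentCode_pow (m := m) (L := L) hd hK.symm
  have hX0 : 0 < Fintype.card X := by
    rcases Nat.eq_zero_or_pos (Fintype.card X) with h | h
    · rw [h, mul_zero] at hX
      exact absurd hX (not_le.2 (pow_pos hA0 _))
    · exact h
  have hX0' : (0 : ℝ) < Fintype.card X := by exact_mod_cast hX0
  have hL0' : (0 : ℝ) < L := by exact_mod_cast hL0
  have hlogX : (L : ℝ) ^ K * (2 * m - Real.logb 2 (2 * m) - 1) ≤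
      Real.logb 2 (Fintype.card X) := by
    have h : (A : ℝ) ^ L ^ K ≤ (Q : ℝ) ^ (L + 1) ^ K * Fintype.card X := by exact_mod_cast hX
    have := Real.logb_le_logb_of_le h12 (by positivity) h
    rw [Real.logb_mul (by positivity) hX0'.ne', Real.logb_pow, Real.logb_pow] at this
    push_cast at this
    have h1 : ((L : ℝ) + 1) ^ K = L ^ K * (1 + 1 / (L : ℝ)) ^ K := by
      rw [← mul_pow]; congr 1; field_simp
    rw [h1] at this
    have h2 := mul_le_mul_of_nonneg_left hL.le (by positivity : (0 : ℝ) ≤ (L : ℝ) ^ K)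
    linarith
  refine ⟨X, P, inferInstance, inferInstance, f, hf, ?_, ?_⟩
  · by_contra h
    have h1 : Fintype.card X = 1 := by omega
    rw [h1, Nat.cast_one, Real.logb_one] at hlogX
    exact absurd hlogX (not_le.2 (by positivity))
  · rw [div_lt_iff₀ hden] at hm
    rw [hP]
    push_cast
    calc (L : ℝ) ^ K * (d * m)
        ≤ L ^ K * ((d / 2 + ε) * (2 * m - Real.logb 2 (2 * m) - 1)) := by gcongr
      _ = (d / 2 + ε) * (L ^ K * (2 * m - Real.logb 2 (2 * m) - 1)) := by ring
      _ ≤ _ := by gcongr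

theorem IsIndependentCode.pow {X P A : Type*} {f : X → P → A} (hf : IsIndependentCode f) (s : ℕ) :
    IsIndependentCode fun (x : Fin s → X) (p : Fin s × P) => f (x p.1) p.2 := by
  intro x y hxy j k hjk
  obtain ⟨i, hi⟩ := Function.ne_iff.1 hxy
  obtain ⟨p, hp⟩ := hf _ _ hi j k hjk
  exact ⟨(i, p), hp⟩

theorem IsIndependentCode.scc_le {X P : Type*} [Fintype X] [Fintype P] {d : ℕ} {f : X → P → Fin d}
    (hf : IsIndependentCode f) (hX : 1 < Fintype.card X) (t : ℕ) :
    (SimpleGraph.completeEquipartiteGraph t d).scc ≤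
      t * (Nat.clog (Fintype.card X) t * Fintype.card P + d) := by
  obtain ⟨e⟩ := Function.Embedding.nonempty_of_card_le (α := Fin t)
    (β := Fin (Nat.clog (Fintype.card X) t) → X)
    (by simpa using Nat.le_pow_clog hX t)
  have := SimpleGraph.scc_completeEquipartiteGraph_le
    (fun (i : Fin t) (p : Fin (Nat.clog (Fintype.card X) t) × P) => f (e i p.1) p.2)
    (fun x y hxy => hf.pow _ (e x) (e y) (e.injective.ne hxy))
  simpa using this

theorem corollary4 (d : ℕ) (hd : 2 ≤ d) :
    Filter.Tendsto
      (fun t : ℕ => ((SimpleGraph.completeEquipartiteGraph t d).scc : ℝ) /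
        ((t : ℝ) * Real.logb 2 (t : ℝ)))
      Filter.atTop (nhds ((d : ℝ) / 2)) := by
  have h12 : (1 : ℝ) < 2 := by norm_num
  refine tendsto_order.2 ⟨fun a ha => ?_, fun a ha => ?_⟩
  · filter_upwards [eventually_gt_atTop 1] with t ht
    have ht' : (1 : ℝ) < t := by exact_mod_cast ht
    have hlog : 0 < Real.logb 2 t := Real.logb_pos h12 ht'
    refine ha.trans_le ((le_div_iff₀ (by positivity)).2 ?_)
    exact SimpleGraph.scc_completeEquipartiteGraph_ge t d hd
  · obtain ⟨X, P, _, _, f, hf, hX, hP⟩ :=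
      exists_isIndependentCode_card_le hd (ε := (a - d / 2) / 2) (by linarith)
    set n : ℝ := (Fintype.card P : ℝ) with hn
    set l : ℝ := Real.logb 2 (Fintype.card X) with hl
    have hX' : (1 : ℝ) < Fintype.card X := by exact_mod_cast hX
    have hl0 : 0 < l := Real.logb_pos h12 hX'
    have hlogt : Tendsto (fun t : ℕ => Real.logb 2 (t : ℝ)) atTop atTop :=
      (Real.tendsto_logb_atTop h12).comp tendsto_natCast_atTop_atTop
    have hlim : Tendsto (fun t : ℕ => n / l + (n + d) / Real.logb 2 (t : ℝ)) atTop
        (𝓝 (n / l + 0)) := tendsto_const_nhds.add (hlogt.const_div_atTop _)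
    have hlt : n / l + 0 < a := by
      rw [add_zero, div_lt_iff₀ hl0]
      refine hP.trans_lt ?_
      gcongr
      linarith
    filter_upwards [hlim.eventually (gt_mem_nhds hlt), eventually_gt_atTop 1] with t hlt ht
    refine lt_of_le_of_lt ?_ hlt
    have ht' : (1 : ℝ) < t := by exact_mod_cast ht
    have hlog : 0 < Real.logb 2 t := Real.logb_pos h12 ht'
    have hscc : ((SimpleGraph.completeEquipartiteGraph t d).scc : ℝ) ≤
        t * (Nat.clog (Fintype.card X) t * n + d) := by
      rw [hn]; exact_mod_cast hf.scc_le hX t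
    -- Rounding up costs one block of length `n`, hence only `n / log₂ t` in the ratio.
    have hclog : (Nat.clog (Fintype.card X) t : ℝ) ≤ Real.logb 2 t / l + 1 := by
      rw [← Real.natCeil_logb_natCast]
      have h0 : 0 ≤ Real.logb (Fintype.card X) t := Real.logb_nonneg hX' ht'.le
      refine (Nat.ceil_lt_add_one h0).le.trans_eq ?_
      have hlogX : Real.log (Fintype.card X) ≠ 0 := (Real.log_pos hX').ne'
      have hlog2 : Real.log 2 ≠ 0 := (Real.log_pos h12).ne'
      rw [hl]
      simp only [Real.logb]
      field_simp
    rw [div_le_iff₀ (by positivity)]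
    refine hscc.trans ?_
    calc (t : ℝ) * (Nat.clog (Fintype.card X) t * n + d)
        ≤ t * ((Real.logb 2 t / l + 1) * n + d) := by gcongr
      _ = _ := by field_simp; ring
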